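/- **Theorem 1.1.** Let $n\ge 1$ and let $\mathbf r=(r_1,\dots,r_n)$ satisfy $r_i>0$ and $\sum_{i=1}^n r_i=1$. Let $$\mathbf{Bad}(\mathbf r)=\Big\{\mathbf x\in\mathbb R^n:\ \exists\, c>0\ \ \forall\,\mathbf p\in\mathbb Z^n,\ q\in\mathbb N_{\ge 1}:\ \max_{1\le i\le n}|qx_i-p_i|^{1/r_i}\ge \frac cq\Big\}$$ be the set of $\mathbf r$-badly approximable vectors, and for $t\in\mathbb R$ let $\Phi_t=\mathrm{diag}(e^{-(1+r_1)t},\dots,e^{-(1+r_n)t})$. *The modified Schmidt game induced by $\{\Phi_t: t>0\}$.* Let $D_0\subset\mathbb R^n$ be admissible, i.e. compact with nonempty interior. For $(x,t)\in\mathbb R^n\times\mathbb R$ put $\psi(x,t)=\Phi_t(D_0)+x$, and write $(x',t')\le(x,t)$ if $\psi(x',t')\subset\psi(x,t)$. Let $a_*\ge 0$ be a number with the property (MSG0) for all $(x,t)\in\mathbb R^n\times\mathbb R$ and all $s>a_*$ there is $x'\in\mathbb R^n$ with $(x',t+s)\le(x,t)$. For $a,b>a_*$, the $(a,b)$-game is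 played as follows. Bob chooses $\omega_1=(x_1,t_1)\in\mathbb R^n\times\mathbb R$; then, for $k=1,2,\dots$, Alice chooses $\omega_k'=(x_k',t_k+a)\le\omega_k$, and Bob chooses $\omega_{k+1}=(x_{k+1},t_{k+1})\le\omega_k'$ with $t_{k+1}=t_k+a+b$. A set $S\subset\mathbb R^n$ is *$(a,b)$-winning* if Alice has a strategy guaranteeing $\bigcap_{k\ge1}\psi(\omega_k)\subset S$ however Bob plays. It is *$a$-winning* if it is $(a,b)$-winning for every $b>a_*$, and *winning* if it is $a$-winning for some $a>a_*$. Then: 1. For every admissible $D_0$, some $a_*\ge 0$ satisfies (MSG0), and for every such $a_*$ the set $\mathbf{Bad}(\mathbf r)$ is a winning set of the modified Schmidt game induced by $\{\Phi_t:t>0\}$ with initial domain $D_0$. 2. $\mathbf{Bad}(\mathbf r)$ is thick: for every nonempty open $U\subset\mathbb R^n$, the set $\mathbf{Bad}(\mathbf r)\cap U$ has Hausdorff dimension $n$. -/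

import Mathlib

/-- The set of `r`-badly approximable vectors in `ℝⁿ`: there is `c > 0` such that
`max_i |q x_i - p_i| ^ (1 / r_i) ≥ c / q` for all `p ∈ ℤⁿ` and all integers `q ≥ 1`.
(The supremum is over the finite set of coordinates, so it is a maximum.) -/
def Bad {n : ℕ} (r : Fin n → ℝ) : Set (Fin n → ℝ) :=
  {x | ∃ c : ℝ, 0 < c ∧ ∀ (p : Fin n → ℤ) (q : ℕ), 0 < q →
    c / (q : ℝ) ≤ ⨆ i, |(q : ℝ) * x i - (p i : ℝ)| ^ (1 / r i)}

/-- A subset of `ℝⁿ` is thick if its intersection with every nonempty open set has full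
Hausdorff dimension. -/
def IsThick {n : ℕ} (S : Set (Fin n → ℝ)) : Prop :=
  ∀ U : Set (Fin n → ℝ), IsOpen U → U.Nonempty → dimH (S ∩ U) = (n : ENNReal)

namespace MSG

/-! ### Modified Schmidt games on `Ω = E × ℝ`

The data are a relation `le` on `Ω` (the ordering) and a map `ψ` from `Ω` to the subsets of `E`. -/

/-- Every position `(x, t)` admits, for every `s > aStar`, a smaller position at level `t + s`. -/
def MSG0 {E : Type*} (le : E × ℝ → E × ℝ → Prop) (aStar : ℝ) : Prop :=
  ∀ (x : E) (t s : ℝ), aStar < s → ∃ x' : E, le (x', t + s) (x, t)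

/-- The level of Bob's `k`-th move, `k = 0, 1, 2, …`, when his first move has level `t₁`. -/
def bobLevel (a b t₁ : ℝ) (k : ℕ) : ℝ := t₁ + k * (a + b)

/-- The level of Alice's `k`-th move, `k = 0, 1, 2, …`. -/
def aliceLevel (a b t₁ : ℝ) (k : ℕ) : ℝ := t₁ + k * (a + b) + a

/-- A strategy for Alice: given Bob's initial level `t₁` and the points `x 0, …, x k` that Bob has
chosen so far, it returns Alice's `k`-th point. (Alice's own earlier points and all the levels are
determined by these data and the parameters of the game.) -/
def Strategy (E : Type*) : Type _ := ℝ → (k : ℕ) → (Fin (k + 1) → E) → E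

/-- Bob's `k`-th position `(x k, t_k)` when he plays the points `x 0, x 1, …`. -/
def bobPos {E : Type*} (a b t₁ : ℝ) (x : ℕ → E) (k : ℕ) : E × ℝ :=
  (x k, bobLevel a b t₁ k)

/-- Alice's `k`-th position when she follows the strategy `σ` against Bob's points `x 0, x 1, …`. -/
def alicePos {E : Type*} (a b : ℝ) (σ : Strategy E) (t₁ : ℝ) (x : ℕ → E) (k : ℕ) : E × ℝ :=
  (σ t₁ k (fun i => x i), aliceLevel a b t₁ k)

/-- `S` is `(a, b)`-winning: Alice has a strategy whose moves are legal as long as Bob's moves are,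
and such that whenever Bob plays legally all the time, the intersection of the sets
chosen by Bob is contained in `S`. -/
def IsABWinning {E : Type*} (le : E × ℝ → E × ℝ → Prop) (ψ : E × ℝ → Set E) (a b : ℝ)
    (S : Set E) : Prop :=
  ∃ σ : Strategy E, ∀ (t₁ : ℝ) (x : ℕ → E),
    (∀ k : ℕ,
      (∀ j < k, le (bobPos a b t₁ x (j + 1)) (alicePos a b σ t₁ x j)) →
        le (alicePos a b σ t₁ x k) (bobPos a b t₁ x k)) ∧
    ((∀ j : ℕ, le (bobPos a b t₁ x (j + 1)) (alicePos a b σ t₁ x j)) →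
      ⋂ k : ℕ, ψ (bobPos a b t₁ x k) ⊆ S)

/-- `S` is `a`-winning: it is `(a, b)`-winning for every `b > aStar`. -/
def IsAWinning {E : Type*} (le : E × ℝ → E × ℝ → Prop) (ψ : E × ℝ → Set E) (aStar a : ℝ)
    (S : Set E) : Prop :=
  ∀ b : ℝ, aStar < b → IsABWinning le ψ a b S

/-- `S` is winning: it is `a`-winning for some `a > aStar`. -/
def IsWinning {E : Type*} (le : E × ℝ → E × ℝ → Prop) (ψ : E × ℝ → Set E) (aStar : ℝ)
    (S : Set E) : Prop :=
  ∃ a : ℝ, aStar < a ∧ IsAWinning le ψ aStar a S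

/-! ### Games induced by a family `Φ` of self-maps of `ℝⁿ` -/

/-- An admissible initial domain: compact with nonempty interior. -/
def IsAdmissible {n : ℕ} (D₀ : Set (Fin n → ℝ)) : Prop :=
  IsCompact D₀ ∧ (interior D₀).Nonempty

/-- `ψ (x, t) = Φ_t(D₀) + x`. -/
def inducedPsi {n : ℕ} (Φ : ℝ → (Fin n → ℝ) →ₗ[ℝ] (Fin n → ℝ)) (D₀ : Set (Fin n → ℝ))
    (ω : (Fin n → ℝ) × ℝ) : Set (Fin n → ℝ) :=
  (fun y => Φ ω.2 y + ω.1) '' D₀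

/-- `ω' ≤ ω` if and only if `ψ ω' ⊆ ψ ω`. -/
def inducedLe {n : ℕ} (Φ : ℝ → (Fin n → ℝ) →ₗ[ℝ] (Fin n → ℝ)) (D₀ : Set (Fin n → ℝ))
    (ω' ω : (Fin n → ℝ) × ℝ) : Prop :=
  inducedPsi Φ D₀ ω' ⊆ inducedPsi Φ D₀ ω

end MSG

/-- `Φ_t = diag(e^{-(1+r_1)t}, …, e^{-(1+r_n)t})`. -/
noncomputable def weightedContraction {n : ℕ} (r : Fin n → ℝ) (t : ℝ) :
    (Fin n → ℝ) →ₗ[ℝ] (Fin n → ℝ) :=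
  Matrix.toLin' (Matrix.diagonal fun i => Real.exp (-((1 + r i) * t)))

/-! Since the weights sum to one, `Φ_t` has determinant `e^{-(n+1)t}`, which exactly balances `n +
1` denominators of size `e^t`. Hence `n + 1` rational vectors with denominators at most `c e^t`
lying in a bounded `Φ_t`-rescaled region have an integer determinant of absolute value below one,
and all such vectors lie on one hyperplane (`exists_hyperplane`). With a sufficiently large step
`a`, Alice can place her set at a fixed rescaled distance from these vectors
(`exists_avoiding_move`). Each `p / q` is thus avoided at the first level with `q ≤ c e^{t_k}`.
There `e^{t_k}` is at most a constant times `q`, so some `|q y_i - p_i|` is at least a constant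
times `q^{-r_i}`, which is bad approximability. The step `a` does not depend on `b`, and Alice's
move depends only on Bob's current position.

For thickness, the game is played with boxes, and Bob's moves range over a grid in Alice's box. All
plays together give a Cantor set inside `Bad r ∩ U`. Compared with filling the whole box, one round
loses at most a factor `e^L` in the number of cells, with `L` independent of `b`. The mass
distribution principle (`le_dimH_range_of_coding`) gives every dimension below `n - L / (a + b)`,
which tends to `n` as `b` grows. -/

/-! ### Simplex lemma: rational vectors of small denominator lie on a hyperplane. -/

section LinearAlgebra

/-- If every square matrix with rows in `S` is singular, then some nonzero linear functional
vanishes on `S`. -/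
lemma exists_dual_ne_zero_of_forall_det_eq_zero {ι K : Type*} [Fintype ι] [DecidableEq ι] [Field K]
    (S : Set (ι → K)) (h : ∀ v : ι → ι → K, (∀ i, v i ∈ S) → (Matrix.of v).det = 0) :
    ∃ f : Module.Dual K (ι → K), f ≠ 0 ∧ ∀ v ∈ S, f v = 0 := by
  by_cases htop : Submodule.span K S = ⊤
  · exfalso
    let b := Module.Basis.ofSpan htop.ge
    have hb : ∀ i, b i ∈ S := fun i => Module.Basis.ofSpan_subset htop.ge ⟨i, rfl⟩
    let b' := b.reindex (b.indexEquiv (Pi.basisFun K ι))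
    have hb' : ∀ i, b' i ∈ S := fun i => by
      simp only [b', Module.Basis.reindex_apply]
      exact hb _
    have hunit := (Matrix.linearIndependent_rows_iff_isUnit (A := Matrix.of b')).1
      b'.linearIndependent
    rw [Matrix.isUnit_iff_isUnit_det, h b' hb'] at hunit
    exact not_isUnit_zero hunit
  · obtain ⟨f, hf, hle⟩ := Submodule.exists_le_ker_of_lt_top _ (lt_top_iff_ne_top.2 htop)
    exact ⟨f, hf, fun v hv => hle (Submodule.subset_span hv)⟩

end LinearAlgebra

section Simplex

variable {n : ℕ} {r : Fin n → ℝ}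

/-- The determinant of `Φ_t`, which depends on the weights only through their sum. -/
lemma prod_exp_weights (hsum : ∑ i, r i = 1) (t : ℝ) :
    ∏ i, Real.exp (-((1 + r i) * t)) = Real.exp (-((n + 1) * t)) := by
  rw [← Real.exp_sum, Finset.sum_neg_distrib, ← Finset.sum_mul, Finset.sum_add_distrib, hsum]
  simp

/-- The determinant form of the weighted simplex lemma: `n + 1` rational vectors `p j / q j` with
small denominators lie on a hyperplane as soon as their rescalings `u j` are bounded by `B`. -/
lemma det_rescaled_eq_zero (hsum : ∑ i, r i = 1) {t c B : ℝ} (hB : 1 ≤ B) (hc0 : 0 < c)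
    (hc : ((1 + n).factorial : ℝ) * (B * c) ^ (1 + n) < 1) (x : Fin n → ℝ)
    (u : Unit ⊕ Fin n → Fin n → ℝ) (hu : ∀ j i, |u j i| ≤ B) (q : Unit ⊕ Fin n → ℕ)
    (p : Unit ⊕ Fin n → Fin n → ℤ) (hq0 : ∀ j, 0 < q j) (hq : ∀ j, (q j : ℝ) ≤ c * Real.exp t)
    (hp : ∀ j i, (p j i : ℝ) = q j * (x i + Real.exp (-((1 + r i) * t)) * u j i)) :
    (Matrix.of fun j => Sum.elim (fun _ : Unit => (1 : ℝ)) (u j)).det = 0 := by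
  set M := Matrix.of fun j => Sum.elim (fun _ : Unit => (1 : ℝ)) (u j) with hM
  let T : Matrix (Unit ⊕ Fin n) (Unit ⊕ Fin n) ℝ := Matrix.fromBlocks 1 (Matrix.of fun _ i => x i) 0
    (Matrix.diagonal fun i => Real.exp (-((1 + r i) * t)))
  let Z : Matrix (Unit ⊕ Fin n) (Unit ⊕ Fin n) ℤ :=
    Matrix.of fun j => Sum.elim (fun _ : Unit => (q j : ℤ)) (p j)
  -- `T` undoes the rescaling: the integer row `(q, p)` equals `q • (1, u) T`.
  have hZ : Z.map (Int.cast : ℤ → ℝ) = Matrix.diagonal (fun j => (q j : ℝ)) * (M * T) := by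
    ext j k
    rw [Matrix.diagonal_mul, Matrix.mul_apply]
    rcases k with k | k
    · simp [Z, M, T]
    · simp [Z, M, T, hp, Matrix.diagonal_apply, mul_comm]
  have hdet : (Z.det : ℝ) = (∏ j, (q j : ℝ)) * (M.det * Real.exp (-((n + 1) * t))) := by
    have : (Z.det : ℝ) = (Z.map (Int.cast : ℤ → ℝ)).det := (Int.castRingHom ℝ).map_det Z
    rw [this, hZ, Matrix.det_mul, Matrix.det_mul, Matrix.det_diagonal, Matrix.det_fromBlocks_zero₂₁,
      Matrix.det_one, one_mul, Matrix.det_diagonal, prod_exp_weights hsum]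
  have hMdet : |M.det| ≤ ((1 + n).factorial : ℝ) * B ^ (1 + n) := by
    have := Matrix.det_le (A := M) (abv := AbsoluteValue.abs) (x := B) (by
      rintro j (k | k)
      · simpa [M] using hB
      · simpa [M] using hu j k)
    simpa using this
  have hprod : ∏ j, (q j : ℝ) ≤ (c * Real.exp t) ^ (1 + n) := by
    have := Finset.prod_le_prod (s := Finset.univ) (fun j _ => Nat.cast_nonneg (α := ℝ) (q j))
      (fun j _ => hq j)
    simpa using this
  have hlt : |(Z.det : ℝ)| < 1 := by
    rw [hdet, abs_mul, abs_mul, Real.abs_exp, abs_of_nonneg (Finset.prod_nonneg fun j _ =>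
      Nat.cast_nonneg _)]
    refine lt_of_le_of_lt (mul_le_mul hprod (mul_le_mul_of_nonneg_right hMdet (Real.exp_nonneg _))
      (by positivity) (by positivity)) ?_
    have hexp : Real.exp t ^ (1 + n) * Real.exp (-((n + 1) * t)) = 1 := by
      rw [← Real.exp_nat_mul, ← Real.exp_add]
      push_cast
      ring_nf
      simp
    calc (c * Real.exp t) ^ (1 + n) * ((1 + n).factorial * B ^ (1 + n) * Real.exp (-((n + 1) * t)))
        = ((1 + n).factorial : ℝ) * (B * c) ^ (1 + n) *
          (Real.exp t ^ (1 + n) * Real.exp (-((n + 1) * t))) := by rw [mul_pow, mul_pow]; ring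
      _ < 1 := by rw [hexp, mul_one]; exact hc
  have hZ0 : Z.det = 0 := Int.abs_lt_one_iff.1 (by exact_mod_cast hlt)
  rw [hZ0, Int.cast_zero, eq_comm, mul_eq_zero] at hdet
  rcases hdet with h | h
  · exact absurd h (Finset.prod_ne_zero_iff.2 fun j _ => by exact_mod_cast (hq0 j).ne')
  · exact (mul_eq_zero.1 h).resolve_right (Real.exp_ne_zero _)

/-- The weighted simplex lemma: in coordinates rescaled by `Φ_t` around `x`, the rational vectors
with denominators at most `c * e ^ t` and of size at most `B` lie on an affine hyperplane. -/
lemma exists_hyperplane (hn : 0 < n) (hsum : ∑ i, r i = 1) {c B : ℝ} (hB : 1 ≤ B) (hc0 : 0 < c)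
    (hc : ((1 + n).factorial : ℝ) * (B * c) ^ (1 + n) < 1) (x : Fin n → ℝ) (t : ℝ) :
    ∃ (w : Fin n → ℝ) (d : ℝ), w ≠ 0 ∧ ∀ (u : Fin n → ℝ) (p : Fin n → ℤ) (q : ℕ), 0 < q →
      (q : ℝ) ≤ c * Real.exp t → (∀ i, |u i| ≤ B) →
      (∀ i, (p i : ℝ) = q * (x i + Real.exp (-((1 + r i) * t)) * u i)) → ∑ i, w i * u i = d := by
  let V : Set (Fin n → ℝ) := {u | (∀ i, |u i| ≤ B) ∧ ∃ (p : Fin n → ℤ) (q : ℕ), 0 < q ∧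
    (q : ℝ) ≤ c * Real.exp t ∧ ∀ i, (p i : ℝ) = q * (x i + Real.exp (-((1 + r i) * t)) * u i)}
  suffices H : ∃ (w : Fin n → ℝ) (d : ℝ), w ≠ 0 ∧ ∀ u ∈ V, ∑ i, w i * u i = d by
    obtain ⟨w, d, hw, h⟩ := H
    exact ⟨w, d, hw, fun u p q h1 h2 h3 h4 => h u ⟨h3, p, q, h1, h2, h4⟩⟩
  rcases V.eq_empty_or_nonempty with hV | ⟨u₀, hu₀⟩
  · exact ⟨fun _ => 1, 0, fun h => one_ne_zero (congrFun h ⟨0, hn⟩), by simp [hV]⟩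
  obtain ⟨f, hf, hfV⟩ := exists_dual_ne_zero_of_forall_det_eq_zero
    ((fun u => Sum.elim (fun _ : Unit => (1 : ℝ)) u) '' V) (by
      intro v hv
      choose u huV huv using hv
      choose hu p q hq0 hq hp using huV
      rw [← funext huv]
      exact det_rescaled_eq_zero hsum hB hc0 hc x u hu q p hq0 hq hp)
  have hfexp : ∀ u : Fin n → ℝ, f (Sum.elim (fun _ : Unit => (1 : ℝ)) u) =
      f (Pi.single (Sum.inl ()) 1) + ∑ i, f (Pi.single (Sum.inr i) 1) * u i := by
    intro u
    rw [LinearMap.pi_apply_eq_sum_univ f]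
    simp only [Fintype.sum_sum_type, Finset.univ_unique, Finset.sum_singleton, Sum.elim_inl,
      Sum.elim_inr, one_mul, smul_eq_mul]
    congr 1
    · congr 1
      ext j
      simp [Pi.single_apply, eq_comm]
    · refine Finset.sum_congr rfl fun i _ => ?_
      rw [mul_comm]
      congr 2
      ext j
      simp [Pi.single_apply, eq_comm]
  refine ⟨fun i => f (Pi.single (Sum.inr i) 1), - f (Pi.single (Sum.inl ()) 1), ?_, ?_⟩
  -- If the linear part vanished, `f` would reduce to its constant term, which is zero because `f`
  -- vanishes at `u₀`; then `f = 0`.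
  · intro hw
    have h0 := hfV _ ⟨u₀, hu₀, rfl⟩
    simp only [hfexp] at h0
    have hw' := fun i => congrFun hw i
    simp only [Pi.zero_apply] at hw'
    simp only [hw', zero_mul, Finset.sum_const_zero, add_zero] at h0
    refine hf (LinearMap.pi_ext' fun j => LinearMap.ext_ring ?_)
    rcases j with ⟨⟩ | j
    · simpa using h0
    · simpa using hw' j
  · intro u hu
    have h0 := hfV _ ⟨u, hu, rfl⟩
    simp only [hfexp] at h0
    linarith

end Simplex

/-! ### Alice's strategy and the winning property. -/

section Game

open MSG

variable {n : ℕ} {r : Fin n → ℝ} {D₀ : Set (Fin n → ℝ)}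

lemma mem_inducedPsi_weightedContraction {x y : Fin n → ℝ} {t : ℝ} :
    y ∈ inducedPsi (weightedContraction r) D₀ (x, t) ↔
      ∃ z ∈ D₀, ∀ i, y i = Real.exp (-((1 + r i) * t)) * z i + x i := by
  simp only [inducedPsi, weightedContraction, Set.mem_image, funext_iff, Pi.add_apply,
    Matrix.toLin'_apply, Matrix.mulVec_diagonal]
  exact exists_congr fun z => and_congr_right fun _ => forall_congr' fun i => eq_comm

/-- A deep position centred at the point of `ψ (x, t)` with rescaled coordinates `z` stays
`δ`-close to that point in rescaled coordinates. -/
lemma exists_rescaled_near (hr : ∀ i, 0 < r i) {R δ s : ℝ} (hD : ∀ z ∈ D₀, ∀ i, |z i| ≤ R)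
    (hs : 0 ≤ s) (hδ : R * Real.exp (-s) ≤ δ) {x y z : Fin n → ℝ} {t : ℝ}
    (hy : y ∈ inducedPsi (weightedContraction r) D₀
      (fun i => Real.exp (-((1 + r i) * t)) * z i + x i, t + s)) :
    ∃ u : Fin n → ℝ, (∀ i, |u i - z i| ≤ δ) ∧
      ∀ i, y i = Real.exp (-((1 + r i) * t)) * u i + x i := by
  obtain ⟨v, hv, hyv⟩ := mem_inducedPsi_weightedContraction.1 hy
  refine ⟨fun i => z i + Real.exp (-((1 + r i) * s)) * v i, fun i => ?_, fun i => ?_⟩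
  · have hexp : Real.exp (-((1 + r i) * s)) ≤ Real.exp (-s) :=
      Real.exp_le_exp.2 (by nlinarith [hr i])
    rw [add_sub_cancel_left, abs_mul, Real.abs_exp, mul_comm]
    exact (mul_le_mul (hD v hv i) hexp (Real.exp_nonneg _) ((abs_nonneg _).trans (hD v hv i))).trans
      hδ
  · have hexp : Real.exp (-((1 + r i) * (t + s))) =
        Real.exp (-((1 + r i) * t)) * Real.exp (-((1 + r i) * s)) := by
      rw [← Real.exp_add]
      ring_nf
    rw [hyv i, hexp]
    ring

lemma exists_forall_mul_exp_neg_le (R : ℝ) {δ : ℝ} (hδ : 0 < δ) :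
    ∃ a : ℝ, 0 ≤ a ∧ ∀ s, a ≤ s → R * Real.exp (-s) ≤ δ := by
  have h : Filter.Tendsto (fun s : ℝ => R * Real.exp (-s)) Filter.atTop (nhds 0) := by
    simpa using Real.tendsto_exp_neg_atTop_nhds_zero.const_mul R
  obtain ⟨a, ha⟩ := Filter.eventually_atTop.1 (h.eventually (ge_mem_nhds hδ))
  exact ⟨max a 0, le_max_right _ _, fun s hs => ha s ((le_max_left _ _).trans hs)⟩

lemma MSG.IsAdmissible.exists_ball (h : IsAdmissible D₀) :
    ∃ (z : Fin n → ℝ) (ρ R : ℝ), 0 < ρ ∧ 0 ≤ R ∧ (∀ u : Fin n → ℝ, (∀ i, |u i - z i| ≤ ρ) → u ∈ D₀) ∧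
      ∀ u ∈ D₀, ∀ i, |u i| ≤ R := by
  obtain ⟨hc, z, hz⟩ := h
  obtain ⟨ρ, hρ, hball⟩ := Metric.nhds_basis_closedBall.mem_iff.1 (mem_interior_iff_mem_nhds.1 hz)
  obtain ⟨R, hR⟩ := hc.isBounded.exists_norm_le
  refine ⟨z, ρ, R, hρ, ?_, fun u hu => hball ?_, fun u hu i => ?_⟩
  · exact (norm_nonneg z).trans (hR z (interior_subset hz))
  · rw [Metric.mem_closedBall, dist_pi_le_iff hρ.le]
    exact hu
  · exact (norm_le_pi_norm u i).trans (hR u hu)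

/-- A copy of `D₀` contracted by a further time `s`, centred at an interior point of `D₀`, has
rescaled radius at most `R e^{-s}` and fits into the inner ball. -/
theorem exists_msg0 (hr : ∀ i, 0 < r i) (h : IsAdmissible D₀) :
    ∃ aStar : ℝ, 0 ≤ aStar ∧ MSG0 (inducedLe (weightedContraction r) D₀) aStar := by
  obtain ⟨z, ρ, R, hρ, -, hin, hout⟩ := h.exists_ball
  obtain ⟨a, ha0, ha⟩ := exists_forall_mul_exp_neg_le R hρ
  refine ⟨a, ha0, fun x t s hs => ⟨fun i => Real.exp (-((1 + r i) * t)) * z i + x i, fun y hy => ?_⟩⟩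
  obtain ⟨u, hu, hyu⟩ := exists_rescaled_near hr hout (ha0.trans hs.le) (ha s hs.le) hy
  exact mem_inducedPsi_weightedContraction.2 ⟨u, hin u hu, hyu⟩

/-- One of the two points `z ± ρ • sign w` is at distance at least `ρ` from the
hyperplane `w · u = d`, measured by the functional `w`. -/
lemma exists_far_from_hyperplane (w : Fin n → ℝ) (d : ℝ) (z : Fin n → ℝ) {ρ : ℝ} (hρ : 0 ≤ ρ) :
    ∃ u : Fin n → ℝ, (∀ i, |u i - z i| ≤ ρ) ∧ ρ * ∑ i, |w i| ≤ |∑ i, w i * u i - d| := by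
  have hsign : ∀ i, |(SignType.sign (w i) : ℝ)| ≤ 1 := fun i => by
    rcases lt_trichotomy (w i) 0 with h | h | h <;> simp [h]
  have hle : ∀ i, |ρ * (SignType.sign (w i) : ℝ)| ≤ ρ := fun i => by
    rw [abs_mul, abs_of_nonneg hρ]
    exact mul_le_of_le_one_right hρ (hsign i)
  have hsum : ∀ σ : ℝ, ∑ i, w i * (z i + σ * (ρ * (SignType.sign (w i) : ℝ))) =
      ∑ i, w i * z i + σ * (ρ * ∑ i, |w i|) := fun σ => by
    simp only [mul_add, Finset.sum_add_distrib, Finset.mul_sum]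
    congr 1
    refine Finset.sum_congr rfl fun i _ => ?_
    rw [← self_mul_sign (w i)]
    ring
  have hpos : 0 ≤ ρ * ∑ i, |w i| := mul_nonneg hρ (Finset.sum_nonneg fun i _ => abs_nonneg _)
  rcases le_total d (∑ i, w i * z i) with h | h
  · refine ⟨fun i => z i + 1 * (ρ * (SignType.sign (w i) : ℝ)), fun i => ?_, ?_⟩
    · simpa using hle i
    · rw [hsum, abs_of_nonneg] <;> linarith
  · refine ⟨fun i => z i + (-1) * (ρ * (SignType.sign (w i) : ℝ)), fun i => ?_, ?_⟩
    · simpa using hle i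
    · rw [hsum, abs_of_nonpos] <;> linarith

/-- Alice's move: every sufficiently deep level contains a legal move for Alice which stays away
from all rational vectors with denominators at most `c * e ^ t`. -/
lemma exists_avoiding_move (hr : ∀ i, 0 < r i) (hsum : ∑ i, r i = 1) (h : IsAdmissible D₀) :
    ∃ a₀ c ε : ℝ, 0 < c ∧ 0 < ε ∧ ∀ a, a₀ ≤ a → ∀ (x : Fin n → ℝ) (t : ℝ), ∃ x' : Fin n → ℝ,
      inducedLe (weightedContraction r) D₀ (x', t + a) (x, t) ∧
      ∀ y ∈ inducedPsi (weightedContraction r) D₀ (x', t + a), ∀ (p : Fin n → ℤ) (q : ℕ), 0 < q →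
        (q : ℝ) ≤ c * Real.exp t →
          ∃ i, ε * Real.exp (-((1 + r i) * t)) * q ≤ |(q : ℝ) * y i - p i| := by
  have hn : 0 < n := by
    rcases Nat.eq_zero_or_pos n with rfl | hn
    · simp at hsum
    · exact hn
  obtain ⟨z, ρ, R, hρ, hR, hin, hout⟩ := h.exists_ball
  -- `R + ρ` bounds the rational points close to `D₀`; the `1` bounds the column of ones in the
  -- determinant.
  set B : ℝ := max 1 (R + ρ) with hBdef
  have hB : 1 ≤ B := le_max_left _ _
  set K : ℝ := ((1 + n).factorial : ℝ) * B with hK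
  have hfac : (1 : ℝ) ≤ ((1 + n).factorial : ℝ) := by
    exact_mod_cast Nat.one_le_iff_ne_zero.2 (Nat.factorial_ne_zero _)
  have hKpos : 0 < K := by positivity
  have hc : ((1 + n).factorial : ℝ) * (B * (1 / (2 * K))) ^ (1 + n) < 1 := by
    have h1 : B * (1 / (2 * K)) = 1 / (2 * ((1 + n).factorial : ℝ)) := by
      rw [hK]
      field_simp
    have h2 : 1 / (2 * ((1 + n).factorial : ℝ)) ≤ 1 := by
      rw [div_le_one (by positivity)]
      linarith
    rw [h1]
    calc ((1 + n).factorial : ℝ) * (1 / (2 * ((1 + n).factorial : ℝ))) ^ (1 + n)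
        ≤ ((1 + n).factorial : ℝ) * (1 / (2 * ((1 + n).factorial : ℝ))) := by
          refine mul_le_mul_of_nonneg_left (pow_le_of_le_one (by positivity) h2 (by omega))
            (by positivity)
      _ = 1 / 2 := by field_simp
      _ < 1 := by norm_num
  -- The radius `ρ` is shared out: Alice's centre moves by `ρ / 2` and her set has radius `ρ / 4`,
  -- so it stays in `D₀`. A further `ρ / 4` around that set still misses the hyperplane.
  have hδ : 0 < ρ / 4 := by positivity
  obtain ⟨a₀, ha₀, ha⟩ := exists_forall_mul_exp_neg_le R hδ
  refine ⟨a₀, 1 / (2 * K), ρ / 4, by positivity, hδ, fun a hle x t => ?_⟩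
  obtain ⟨w, d, hw, hwd⟩ := exists_hyperplane hn hsum hB (by positivity) hc x t
  obtain ⟨u₀, hu₀, hfar⟩ := exists_far_from_hyperplane w d z (half_pos hρ).le
  have hsub : inducedLe (weightedContraction r) D₀
      (fun i => Real.exp (-((1 + r i) * t)) * u₀ i + x i, t + a) (x, t) := by
    intro y hy
    obtain ⟨u, hu, hyu⟩ := exists_rescaled_near hr hout (ha₀.trans hle) (ha a hle) hy
    refine mem_inducedPsi_weightedContraction.2 ⟨u, hin u fun i => ?_, hyu⟩
    have := abs_sub_le (u i) (u₀ i) (z i)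
    linarith [hu i, hu₀ i]
  refine ⟨_, hsub, fun y hy p q hq hqt => ?_⟩
  obtain ⟨u, hu, hyu⟩ := exists_rescaled_near hr hout (ha₀.trans hle) (ha a hle) hy
  have huR : ∀ i, |u i| ≤ R := by
    obtain ⟨u', hu', hyu'⟩ := mem_inducedPsi_weightedContraction.1 (hsub hy)
    intro i
    have : u i = u' i := mul_left_cancel₀ (Real.exp_ne_zero _) (add_right_cancel
      ((hyu i).symm.trans (hyu' i)))
    exact this ▸ hout u' hu' i
  have hq' : (0 : ℝ) < q := by exact_mod_cast hq
  let v : Fin n → ℝ := fun i => Real.exp ((1 + r i) * t) * (p i / q - x i)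
  have hv : ∀ i, (p i : ℝ) = q * (x i + Real.exp (-((1 + r i) * t)) * v i) := fun i => by
    simp only [v]
    rw [← mul_assoc, ← Real.exp_add, neg_add_cancel, Real.exp_zero]
    field_simp
    ring
  suffices H : ∃ i, ρ / 4 ≤ |u i - v i| by
    obtain ⟨i, hi⟩ := H
    refine ⟨i, ?_⟩
    have : (q : ℝ) * y i - p i = q * Real.exp (-((1 + r i) * t)) * (u i - v i) := by
      rw [hyu i, hv i]
      ring
    rw [this, abs_mul, abs_of_nonneg (by positivity)]
    calc ρ / 4 * Real.exp (-((1 + r i) * t)) * q = q * Real.exp (-((1 + r i) * t)) * (ρ / 4) := by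
          ring
      _ ≤ _ := by gcongr
  -- A rational point this close would satisfy the size bound `B`, hence lie on the hyperplane, yet
  -- be within less than `ρ / 2` of `u₀` in every coordinate.
  by_contra! hcon
  have hvB : ∀ i, |v i| ≤ B := fun i => by
    have := abs_sub_abs_le_abs_sub (v i) (u i)
    rw [abs_sub_comm] at this
    linarith [huR i, hcon i, le_max_right 1 (R + ρ)]
  have hvd := hwd v p q hq hqt hvB hv
  obtain ⟨i₀, hi₀⟩ := Function.ne_iff.1 hw
  have hnorm : 0 < ∑ i, |w i| :=
    Finset.sum_pos' (fun i _ => abs_nonneg _) ⟨i₀, Finset.mem_univ _, abs_pos.2 hi₀⟩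
  have hclose : ∑ i, w i * u₀ i - d = ∑ i, w i * (u₀ i - v i) := by
    rw [← hvd, ← Finset.sum_sub_distrib]
    exact Finset.sum_congr rfl fun i _ => by ring
  have hupper : |∑ i, w i * u₀ i - d| < ρ / 2 * ∑ i, |w i| := by
    rw [hclose, Finset.mul_sum]
    refine (Finset.abs_sum_le_sum_abs _ _).trans_lt (Finset.sum_lt_sum (fun i _ => ?_)
      ⟨i₀, Finset.mem_univ _, ?_⟩)
    · rw [abs_mul, mul_comm]
      refine mul_le_mul_of_nonneg_right ?_ (abs_nonneg _)
      have := abs_sub_le (u₀ i) (u i) (v i)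
      rw [abs_sub_comm (u₀ i) (u i)] at this
      linarith [hu i, hcon i]
    · rw [abs_mul, mul_comm]
      refine mul_lt_mul_of_pos_right ?_ (abs_pos.2 hi₀)
      have := abs_sub_le (u₀ i₀) (u i₀) (v i₀)
      rw [abs_sub_comm (u₀ i₀) (u i₀)] at this
      linarith [hu i₀, hcon i₀]
  linarith

/-- A vector is badly approximable if every rational vector `p / q` is avoided at a level `τ` with
`e ^ τ` of order at most `q`. -/
lemma mem_bad_of_forall_exists_level (hr : ∀ i, 0 < r i) {y : Fin n → ℝ} {ε κ : ℝ} (hε : 0 < ε)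
    (hκ : 0 < κ) (h : ∀ (p : Fin n → ℤ) (q : ℕ), 0 < q → ∃ (τ : ℝ) (i : Fin n),
      κ / q ≤ Real.exp (-τ) ∧ ε * Real.exp (-((1 + r i) * τ)) * q ≤ |(q : ℝ) * y i - p i|) :
    y ∈ Bad r := by
  obtain ⟨-, i, -, -⟩ := h 0 1 one_pos
  have : Nonempty (Fin n) := ⟨i⟩
  -- Raising `ε κ^{1 + r_i} q^{-r_i}` to the power `1 / r_i` gives `f i / q`; the minimum is taken
  -- because the coordinate `i` varies with `p` and `q`.
  let f : Fin n → ℝ := fun i => (ε * κ ^ (1 + r i)) ^ (1 / r i)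
  obtain ⟨j, hj⟩ := Finite.exists_min f
  refine ⟨f j, by positivity, fun p q hq => ?_⟩
  have hq' : (0 : ℝ) < q := by exact_mod_cast hq
  obtain ⟨τ, i, h1, h2⟩ := h p q hq
  refine le_trans ?_ (le_ciSup (f := fun i => |(q : ℝ) * y i - (p i : ℝ)| ^ (1 / r i))
    (Set.finite_range _).bddAbove i)
  have h3 : ε * κ ^ (1 + r i) * (q : ℝ) ^ (-r i) ≤ |(q : ℝ) * y i - p i| := by
    refine le_trans ?_ h2
    have h4 : (κ / q) ^ (1 + r i) ≤ Real.exp (-((1 + r i) * τ)) := by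
      have := Real.rpow_le_rpow (by positivity) h1 (by linarith [hr i] : 0 ≤ 1 + r i)
      rwa [← Real.exp_mul, neg_mul, mul_comm τ] at this
    have h5 : κ ^ (1 + r i) * (q : ℝ) ^ (-r i) = (κ / q) ^ (1 + r i) * q := by
      rw [Real.div_rpow hκ.le hq'.le, Real.rpow_add hq', Real.rpow_one, Real.rpow_neg hq'.le]
      field_simp
    rw [mul_assoc, h5, ← mul_assoc]
    gcongr
  calc f j / q ≤ f i / q := by gcongr; exact hj i
    _ = (ε * κ ^ (1 + r i) * (q : ℝ) ^ (-r i)) ^ (1 / r i) := by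
      rw [Real.mul_rpow (by positivity) (by positivity), ← Real.rpow_mul hq'.le]
      have : -r i * (1 / r i) = -1 := by
        have := (hr i).ne'
        field_simp
      rw [this, Real.rpow_neg_one, div_eq_mul_inv]
    _ ≤ _ := Real.rpow_le_rpow (by positivity) h3 (by have := hr i; positivity)

/-- Alice can win with a positional strategy `A` with any step `a ≥ a₀`, where `a₀` depends only on
the initial domain. -/
theorem exists_positional_strategy (hr : ∀ i, 0 < r i) (hsum : ∑ i, r i = 1)
    (h : IsAdmissible D₀) : ∃ a₀ : ℝ, ∀ a, a₀ ≤ a → ∃ A : (Fin n → ℝ) → ℝ → Fin n → ℝ,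
      (∀ x t, inducedLe (weightedContraction r) D₀ (A x t, t + a) (x, t)) ∧
      ∀ (b t₁ : ℝ) (x : ℕ → Fin n → ℝ), 0 < a + b →
        (∀ k, inducedLe (weightedContraction r) D₀ (bobPos a b t₁ x (k + 1))
          (A (x k) (bobLevel a b t₁ k), bobLevel a b t₁ k + a)) →
        ⋂ k, inducedPsi (weightedContraction r) D₀ (bobPos a b t₁ x k) ⊆ Bad r := by
  obtain ⟨a₀, c, ε, hc, hε, hmove⟩ := exists_avoiding_move hr hsum h
  refine ⟨a₀, fun a ha => ?_⟩
  choose A hle havoid using hmove a ha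
  refine ⟨A, hle, fun b t₁ x hab hbob y hy => ?_⟩
  -- `y` lies in Bob's next set, hence in Alice's `k`-th set.
  have hlevel : ∀ (k : ℕ) (p : Fin n → ℤ) (q : ℕ), 0 < q →
      (q : ℝ) ≤ c * Real.exp (bobLevel a b t₁ k) →
      ∃ i, ε * Real.exp (-((1 + r i) * bobLevel a b t₁ k)) * q ≤ |(q : ℝ) * y i - p i| := fun k =>
    havoid (x k) (bobLevel a b t₁ k) y (hbob k (Set.mem_iInter.1 hy (k + 1)))
  -- Level `k` is the first with `q ≤ c e^{t_k}`. If `k > 0`, failure one level earlier gives the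
  -- constant `c e^{-(a+b)}`; if `k = 0`, then `q ≥ 1` gives `e^{-t₁}`.
  refine mem_bad_of_forall_exists_level hr hε
    (lt_min (mul_pos hc (Real.exp_pos (-(a + b)))) (Real.exp_pos (-t₁))) fun p q hq => ?_
  have hq' : (1 : ℝ) ≤ q := by exact_mod_cast hq
  have hex : ∃ k, (q : ℝ) ≤ c * Real.exp (bobLevel a b t₁ k) := by
    have hlim : Filter.Tendsto (fun k : ℕ => c * Real.exp (bobLevel a b t₁ k)) Filter.atTop
        Filter.atTop := by
      refine Filter.Tendsto.const_mul_atTop hc (Real.tendsto_exp_atTop.comp ?_)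
      exact Filter.tendsto_atTop_add_const_left _ _
        (tendsto_natCast_atTop_atTop.atTop_mul_const hab)
    exact (hlim.eventually_ge_atTop _).exists
  classical
  obtain ⟨i, hi⟩ := hlevel (Nat.find hex) p q hq (Nat.find_spec hex)
  refine ⟨_, i, ?_, hi⟩
  rcases hk : Nat.find hex with _ | k
  · rw [div_le_iff₀ (by positivity)]
    calc _ ≤ Real.exp (-t₁) := min_le_right _ _
      _ ≤ Real.exp (-t₁) * q := le_mul_of_one_le_right (Real.exp_nonneg _) hq'
      _ = _ := by simp [bobLevel]
  · have hlt : c * Real.exp (bobLevel a b t₁ k) < q :=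
      not_le.1 (Nat.find_min hex (by omega : k < Nat.find hex))
    rw [div_le_iff₀ (by positivity)]
    have hstep : -bobLevel a b t₁ (k + 1) = -(a + b) + -bobLevel a b t₁ k := by
      simp only [bobLevel]
      push_cast
      ring
    rw [hstep, Real.exp_add]
    calc _ ≤ c * Real.exp (-(a + b)) := min_le_left _ _
      _ = Real.exp (-(a + b)) * Real.exp (-bobLevel a b t₁ k) *
            (c * Real.exp (bobLevel a b t₁ k)) := by
          rw [Real.exp_neg (bobLevel a b t₁ k)]
          field_simp
      _ ≤ _ := by gcongr

theorem bad_isABWinning (hr : ∀ i, 0 < r i) (hsum : ∑ i, r i = 1)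
    (h : IsAdmissible D₀) : ∃ a₀ : ℝ, ∀ a b, a₀ ≤ a → 0 < a + b →
      IsABWinning (inducedLe (weightedContraction r) D₀) (inducedPsi (weightedContraction r) D₀)
        a b (Bad r) := by
  obtain ⟨a₀, hA⟩ := exists_positional_strategy hr hsum h
  refine ⟨a₀, fun a b ha hab => ?_⟩
  obtain ⟨A, hle, hwin⟩ := hA a ha
  exact ⟨fun t₁ k x => A (x (Fin.last k)) (bobLevel a b t₁ k), fun t₁ x =>
    ⟨fun k _ => hle (x k) (bobLevel a b t₁ k), fun hbob => hwin b t₁ x hab hbob⟩⟩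

/-- The threshold `a₀` is independent of `b`, so a single `a` above both `a₀` and `aStar` serves
every `b`. -/
theorem bad_isWinning (hr : ∀ i, 0 < r i) (hsum : ∑ i, r i = 1) (h : IsAdmissible D₀) {aStar : ℝ}
    (ha : 0 ≤ aStar) :
    IsWinning (inducedLe (weightedContraction r) D₀) (inducedPsi (weightedContraction r) D₀) aStar
      (Bad r) := by
  obtain ⟨a₀, hwin⟩ := bad_isABWinning hr hsum h
  refine ⟨max a₀ (aStar + 1), (lt_add_one _).trans_le (le_max_right _ _), fun b hb =>
    hwin _ b (le_max_left _ _) ?_⟩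
  linarith [le_max_right a₀ (aStar + 1)]

end Game

/-! ### Mass distribution principle and volume counting. -/

section MassDistribution

open MeasureTheory ProbabilityTheory

/-- The uniform Bernoulli measure gives mass `N⁻ʲ` to cylinders of length `j`. -/
lemma infinitePi_uniformOn_cylinder {α : Type*} [Fintype α] [Nonempty α] [MeasurableSpace α]
    [MeasurableSingletonClass α] (j : ℕ) (w : Fin j → α) :
    Measure.infinitePi (fun _ : ℕ => uniformOn (Set.univ : Set α)) {ω | ∀ i : Fin j, ω i = w i} =
      ((Fintype.card α : ENNReal)⁻¹) ^ j := by
  have hprob : IsProbabilityMeasure (uniformOn (Set.univ : Set α)) :=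
    isProbabilityMeasure_uniformOn Set.finite_univ Set.univ_nonempty
  let T : ℕ → Set α := fun i => if h : i < j then {w ⟨i, h⟩} else Set.univ
  have hset : {ω : ℕ → α | ∀ i : Fin j, ω i = w i} = (↑(Finset.range j) : Set ℕ).pi T := by
    ext ω
    simp only [Set.mem_ofPred_eq, Set.mem_pi, Finset.coe_range, Set.mem_Iio, T]
    refine ⟨fun h i hi => by simpa [hi] using h ⟨i, hi⟩, fun h i => by simpa using h i i.2⟩
  have hval : ∀ i ∈ Finset.range j, uniformOn (Set.univ : Set α) (T i) =
      (Fintype.card α : ENNReal)⁻¹ := fun i hi => by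
    simp [T, Finset.mem_range.1 hi, uniformOn_univ]
  rw [hset, Measure.infinitePi_pi _ (fun i _ => (Set.toFinite _).measurableSet),
    Finset.prod_congr rfl hval, Finset.prod_const, Finset.card_range]

/-- Mass distribution principle for a coded set: if at scale `δ` a ball meets at most
`C * δ ^ s * N ^ j` of the pieces of some level `j`, then the set has dimension at least `s`. -/
theorem le_dimH_range_of_coding {α X : Type*} [Fintype α] [Nonempty α] [MetricSpace X]
    [TopologicalSpace α] [DiscreteTopology α]
    (π : (ℕ → α) → X) (hπ : Continuous π) {C s : ℝ}
    (hcount : ∀ (x : X) (δ : ℝ), 0 < δ → δ ≤ 1 → ∃ j : ℕ,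
      ({w : Fin j → α | ∃ ω : ℕ → α, (∀ i : Fin j, ω i = w i) ∧
        π ω ∈ Metric.closedBall x δ}.ncard : ℝ) ≤ C * δ ^ s * (Fintype.card α : ℝ) ^ j)
    (d : NNReal) (hd : d < s) : (d : ENNReal) ≤ dimH (Set.range π) := by
  borelize α
  borelize X
  have hprob : IsProbabilityMeasure (uniformOn (Set.univ : Set α)) :=
    isProbabilityMeasure_uniformOn Set.finite_univ Set.univ_nonempty
  set ν := Measure.infinitePi (fun _ : ℕ => uniformOn (Set.univ : Set α)) with hν
  have hs : 0 < s := lt_of_le_of_lt d.2 hd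
  have hball : ∀ (x : X) (δ : ℝ), 0 < δ → δ ≤ 1 →
      ν.map π (Metric.closedBall x δ) ≤ ENNReal.ofReal (C * δ ^ s) := by
    intro x δ hδ0 hδ1
    obtain ⟨j, hj⟩ := hcount x δ hδ0 hδ1
    set W := {w : Fin j → α | ∃ ω : ℕ → α, (∀ i : Fin j, ω i = w i) ∧
      π ω ∈ Metric.closedBall x δ} with hW
    have hN : (0 : ℝ) < (Fintype.card α : ℝ) ^ j := by
      have := Fintype.card_pos (α := α)
      positivity
    rw [Measure.map_apply hπ.measurable Metric.isClosed_closedBall.measurableSet]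
    have hsub : π ⁻¹' Metric.closedBall x δ ⊆
        ⋃ w ∈ W.toFinite.toFinset, {ω | ∀ i : Fin j, ω i = w i} := fun ω hω => by
      simp only [Set.mem_iUnion]
      exact ⟨fun i => ω i, (Set.Finite.mem_toFinset _).2 ⟨ω, fun _ => rfl, hω⟩, fun _ => rfl⟩
    calc ν (π ⁻¹' Metric.closedBall x δ)
        ≤ ∑ w ∈ W.toFinite.toFinset, ν {ω | ∀ i : Fin j, ω i = w i} :=
          (measure_mono hsub).trans (measure_biUnion_finset_le _ _)
      _ = ENNReal.ofReal (W.ncard * ((Fintype.card α : ℝ) ^ j)⁻¹) := by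
          simp only [hν, infinitePi_uniformOn_cylinder, Finset.sum_const, nsmul_eq_mul]
          rw [← Set.ncard_eq_toFinset_card W, ENNReal.ofReal_mul (by positivity),
            ENNReal.ofReal_natCast, ENNReal.ofReal_inv_of_pos hN, ENNReal.ofReal_pow (by positivity),
            ENNReal.ofReal_natCast, ENNReal.inv_pow]
      _ ≤ ENNReal.ofReal (C * δ ^ s) := by
          refine ENNReal.ofReal_le_ofReal ?_
          rwa [← div_eq_mul_inv, div_le_iff₀ hN]
  have hlim : ∀ e : ℝ, 0 < e →
      Filter.Tendsto (fun δ : ℝ => C * δ ^ e) (nhdsWithin 0 (Set.Ioi 0)) (nhds 0) := fun e he => by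
    have h := ((Real.continuous_rpow_const he.le).tendsto 0).const_mul C
    rw [Real.zero_rpow he.ne', mul_zero] at h
    exact h.mono_left nhdsWithin_le_nhds
  -- The constant `C` is absorbed by lowering the exponent from `s` to `d`.
  obtain ⟨ε, hε0, hε⟩ : ∃ ε : ℝ, 0 < ε ∧ ∀ δ, 0 < δ → δ ≤ ε → δ ≤ 1 ∧ C * δ ^ s ≤ δ ^ (d : ℝ) := by
    have h1 := (hlim (s - d) (sub_pos.2 hd)).eventually (ge_mem_nhds one_pos)
    have h2 : ∀ᶠ δ : ℝ in nhdsWithin 0 (Set.Ioi 0), δ ≤ 1 :=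
      nhdsWithin_le_nhds (ge_mem_nhds one_pos)
    obtain ⟨ε, hε0, hε⟩ := mem_nhdsGT_iff_exists_Ioc_subset.1 (h1.and h2)
    refine ⟨ε, hε0, fun δ h0 hle => ⟨(hε ⟨h0, hle⟩).2, ?_⟩⟩
    have h3 : C * δ ^ (s - d) ≤ 1 := (hε ⟨h0, hle⟩).1
    calc C * δ ^ s = C * δ ^ (s - d) * δ ^ (d : ℝ) := by
          rw [mul_assoc, ← Real.rpow_add h0, sub_add_cancel]
      _ ≤ 1 * δ ^ (d : ℝ) := by gcongr
      _ = _ := one_mul _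
  have hle : ν.map π ≤ Measure.hausdorffMeasure (d : ℝ) := by
    refine Measure.le_hausdorffMeasure _ _ (ENNReal.ofReal ε) (ENNReal.ofReal_pos.2 hε0)
      fun S hS => ?_
    rcases S.eq_empty_or_nonempty with rfl | ⟨x, hx⟩
    · simp
    have hfin : Metric.ediam S ≠ ⊤ := ne_top_of_le_ne_top ENNReal.ofReal_ne_top hS
    have hsubset : ∀ δ : ℝ, Metric.diam S ≤ δ → S ⊆ Metric.closedBall x δ := fun δ hδ y hy =>
      (Metric.dist_le_diam_of_mem' hfin hy hx).trans hδ
    -- A set of diameter zero lies in balls of every positive radius, so its mass is zero.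
    rcases (Metric.diam_nonneg (s := S)).eq_or_lt with h0 | hpos
    · have : ν.map π S ≤ 0 := by
        have ht := ENNReal.tendsto_ofReal (hlim s hs)
        rw [ENNReal.ofReal_zero] at ht
        refine ge_of_tendsto ht ?_
        filter_upwards [self_mem_nhdsWithin, nhdsWithin_le_nhds (ge_mem_nhds one_pos)] with δ h1 h2
        exact (measure_mono (hsubset δ (h0 ▸ le_of_lt h1))).trans (hball x δ h1 h2)
      exact this.trans zero_le
    · have hdiam : Metric.ediam S = ENNReal.ofReal (Metric.diam S) :=
        (ENNReal.ofReal_toReal hfin).symm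
      have hleε : Metric.diam S ≤ ε := by
        rwa [hdiam, ENNReal.ofReal_le_ofReal_iff hε0.le] at hS
      obtain ⟨h1, h2⟩ := hε _ hpos hleε
      rw [hdiam, ENNReal.ofReal_rpow_of_pos hpos]
      exact ((measure_mono (hsubset _ le_rfl)).trans (hball x _ hpos h1)).trans
        (ENNReal.ofReal_le_ofReal h2)
  refine le_dimH_of_hausdorffMeasure_ne_zero (ne_of_gt ?_)
  calc (0 : ENNReal) < ν (π ⁻¹' Set.range π) := by simp
    _ ≤ ν.map π (Set.range π) := Measure.le_map_apply hπ.measurable.aemeasurable _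
    _ ≤ _ := hle _

/-- Volume bound for the number of disjoint sets of volume `v` in a ball. -/
lemma card_mul_le_of_pairwiseDisjoint {n : ℕ} {ι : Type*} (W : Finset ι) (B : ι → Set (Fin n → ℝ))
    {x : Fin n → ℝ} {R v : ℝ} (hR : 0 ≤ R) (hmeas : ∀ w ∈ W, MeasurableSet (B w))
    (hvol : ∀ w ∈ W, volume (B w) = ENNReal.ofReal v)
    (hdisj : (W : Set ι).PairwiseDisjoint B) (hsub : ∀ w ∈ W, B w ⊆ Metric.closedBall x R) :
    W.card * v ≤ (2 * R) ^ n := by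
  have h : ∑ w ∈ W, volume (B w) ≤ volume (Metric.closedBall x R) := by
    rw [← measure_biUnion_finset hdisj hmeas]
    exact measure_mono (Set.iUnion₂_subset hsub)
  rw [Finset.sum_congr rfl hvol, Real.volume_pi_closedBall _ hR, Finset.sum_const, nsmul_eq_mul,
    ← ENNReal.ofReal_natCast, ← ENNReal.ofReal_mul (by positivity), Fintype.card_fin,
    ENNReal.ofReal_le_ofReal_iff (by positivity)] at h
  exact h

end MassDistribution

/-! ### Nested boxes from plays of the game on the unit cube. -/

section CantorSet

open MSG MeasureTheory

variable {n : ℕ}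

/-- The side lengths of the box `Φ_t([0, 1]ⁿ)`. -/
noncomputable def weightedSide (r : Fin n → ℝ) (t : ℝ) (i : Fin n) : ℝ :=
  Real.exp (-((1 + r i) * t))

/-- Corner of the box chosen by Bob after `k` moves when Alice plays the positional strategy `A` for
boxes, and Bob picks the cell with index `d k` in a grid subdividing Alice's `k`-th box. -/
noncomputable def cellCorner (r : Fin n → ℝ) (A : (Fin n → ℝ) → ℝ → Fin n → ℝ) (a b t₁ : ℝ)
    (x₀ : Fin n → ℝ) {N : Fin n → ℕ} (d : ℕ → (i : Fin n) → Fin (N i)) : ℕ → Fin n → ℝ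
  | 0 => x₀
  | k + 1 => fun i => A (cellCorner r A a b t₁ x₀ d k) (bobLevel a b t₁ k) i +
      weightedSide r (bobLevel a b t₁ (k + 1)) i * (d k i : ℕ)

variable {r : Fin n → ℝ} {A : (Fin n → ℝ) → ℝ → Fin n → ℝ} {a b t₁ : ℝ} {x₀ : Fin n → ℝ}
  {N : Fin n → ℕ}

lemma weightedSide_pos (r : Fin n → ℝ) (t : ℝ) (i : Fin n) : 0 < weightedSide r t i :=
  Real.exp_pos _

lemma weightedSide_add (r : Fin n → ℝ) (t s : ℝ) (i : Fin n) :
    weightedSide r (t + s) i = weightedSide r t i * weightedSide r s i := by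
  rw [weightedSide, weightedSide, weightedSide, ← Real.exp_add]
  ring_nf

lemma weightedSide_le_exp_neg (hr : ∀ i, 0 < r i) {t : ℝ} (ht : 0 ≤ t) (i : Fin n) :
    weightedSide r t i ≤ Real.exp (-t) :=
  Real.exp_le_exp.2 (by nlinarith [hr i])

lemma bobLevel_succ (a b t₁ : ℝ) (k : ℕ) : bobLevel a b t₁ (k + 1) = bobLevel a b t₁ k + a + b := by
  simp only [bobLevel]
  push_cast
  ring

lemma inducedPsi_Icc_zero_one (x : Fin n → ℝ) (t : ℝ) :
    inducedPsi (weightedContraction r) (Set.Icc 0 1) (x, t) = Set.Icc x (x + weightedSide r t) := by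
  ext y
  rw [mem_inducedPsi_weightedContraction, Set.mem_Icc, Pi.le_def, Pi.le_def]
  constructor
  · rintro ⟨z, ⟨hz0, hz1⟩, hy⟩
    refine ⟨fun i => ?_, fun i => ?_⟩
    · have := mul_nonneg (weightedSide_pos r t i).le (hz0 i)
      simp only [weightedSide] at this
      linarith [hy i]
    · have := mul_le_of_le_one_right (weightedSide_pos r t i).le (hz1 i)
      simp only [weightedSide] at this
      simp only [Pi.add_apply, weightedSide]
      linarith [hy i]
  · rintro ⟨h0, h1⟩
    have hside := fun i => weightedSide_pos r t i
    refine ⟨fun i => (y i - x i) / weightedSide r t i, ⟨fun i => ?_, fun i => ?_⟩, fun i => ?_⟩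
    · exact div_nonneg (sub_nonneg.2 (h0 i)) (hside i).le
    · refine (div_le_one (hside i)).2 ?_
      have := h1 i
      simp only [Pi.add_apply] at this
      linarith
    · have := (hside i).ne'
      change y i = weightedSide r t i * ((y i - x i) / weightedSide r t i) + x i
      field_simp
      ring

lemma inducedLe_Icc_iff {x x' : Fin n → ℝ} {t t' : ℝ} :
    inducedLe (weightedContraction r) (Set.Icc 0 1) (x', t') (x, t) ↔
      ∀ i, x i ≤ x' i ∧ x' i + weightedSide r t' i ≤ x i + weightedSide r t i := by
  rw [inducedLe, inducedPsi_Icc_zero_one, inducedPsi_Icc_zero_one, Set.Icc_subset_Icc_iff]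
  · simp only [Pi.le_def, Pi.add_apply, forall_and]
  · exact fun i => le_add_of_nonneg_right (weightedSide_pos r t' i).le

/-- `Bad r` does not depend on the initial domain, so thickness may be derived from the game on the
cube, whose positions are boxes with lower corner `x`. -/
lemma isAdmissible_Icc_zero_one : IsAdmissible (Set.Icc (0 : Fin n → ℝ) 1) := by
  refine ⟨isCompact_Icc, ⟨fun _ => 1 / 2, ?_⟩⟩
  rw [← Set.pi_univ_Icc, interior_pi_set Set.finite_univ]
  intro i _
  simp only [Pi.zero_apply, Pi.one_apply, interior_Icc, Set.mem_Ioo]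
  norm_num

/-- Used for the continuity of the coding and for recovering codes from cells. -/
lemma cellCorner_congr {d d' : ℕ → (i : Fin n) → Fin (N i)} {k : ℕ} (h : ∀ j < k, d j = d' j) :
    cellCorner r A a b t₁ x₀ d k = cellCorner r A a b t₁ x₀ d' k := by
  induction k with
  | zero => rfl
  | succ k ih =>
    ext i
    simp only [cellCorner]
    rw [ih fun j hj => h j (by omega), h k (by omega)]

/-- Bob's cells lie in Alice's boxes. -/
lemma cellCorner_succ_mem (hN : ∀ i, N i * weightedSide r b i ≤ 1)
    (d : ℕ → (i : Fin n) → Fin (N i)) (k : ℕ) (i : Fin n) :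
    A (cellCorner r A a b t₁ x₀ d k) (bobLevel a b t₁ k) i ≤ cellCorner r A a b t₁ x₀ d (k + 1) i ∧
    cellCorner r A a b t₁ x₀ d (k + 1) i + weightedSide r (bobLevel a b t₁ (k + 1)) i ≤
      A (cellCorner r A a b t₁ x₀ d k) (bobLevel a b t₁ k) i +
        weightedSide r (bobLevel a b t₁ k + a) i := by
  have hpos := weightedSide_pos r (bobLevel a b t₁ (k + 1)) i
  refine ⟨by simp only [cellCorner]; exact le_add_of_nonneg_right (by positivity), ?_⟩
  simp only [cellCorner]
  have h1 : ((d k i : ℕ) : ℝ) + 1 ≤ N i := by exact_mod_cast (d k i).2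
  have h2 : weightedSide r (bobLevel a b t₁ (k + 1)) i * N i ≤
      weightedSide r (bobLevel a b t₁ k + a) i := by
    rw [bobLevel_succ, weightedSide_add r _ b, mul_assoc, mul_comm _ (N i : ℝ)]
    exact mul_le_of_le_one_right (weightedSide_pos _ _ _).le (hN i)
  nlinarith [mul_le_mul_of_nonneg_left h1 hpos.le]

lemma cellCorner_le_succ (hA : ∀ x t i, x i ≤ A x t i ∧
      A x t i + weightedSide r (t + a) i ≤ x i + weightedSide r t i)
    (hN : ∀ i, N i * weightedSide r b i ≤ 1)
    (d : ℕ → (i : Fin n) → Fin (N i)) (k : ℕ) (i : Fin n) :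
    cellCorner r A a b t₁ x₀ d k i ≤ cellCorner r A a b t₁ x₀ d (k + 1) i ∧
    cellCorner r A a b t₁ x₀ d (k + 1) i + weightedSide r (bobLevel a b t₁ (k + 1)) i ≤
      cellCorner r A a b t₁ x₀ d k i + weightedSide r (bobLevel a b t₁ k) i :=
  have h := cellCorner_succ_mem (A := A) (a := a) (t₁ := t₁) (x₀ := x₀) hN d k i
  have h' := hA (cellCorner r A a b t₁ x₀ d k) (bobLevel a b t₁ k) i
  ⟨h'.1.trans h.1, h.2.trans h'.2⟩

/-- Half-open cells of level `k` with a common point have the same code. -/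
lemma code_eq_of_mem_cells (hA : ∀ x t i, x i ≤ A x t i ∧
      A x t i + weightedSide r (t + a) i ≤ x i + weightedSide r t i)
    (hN : ∀ i, N i * weightedSide r b i ≤ 1)
    {d d' : ℕ → (i : Fin n) → Fin (N i)} {k : ℕ} {z : Fin n → ℝ}
    (hz : ∀ i, z i ∈ Set.Ico (cellCorner r A a b t₁ x₀ d k i)
      (cellCorner r A a b t₁ x₀ d k i + weightedSide r (bobLevel a b t₁ k) i))
    (hz' : ∀ i, z i ∈ Set.Ico (cellCorner r A a b t₁ x₀ d' k i)
      (cellCorner r A a b t₁ x₀ d' k i + weightedSide r (bobLevel a b t₁ k) i)) :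
    ∀ j < k, d j = d' j := by
  induction k with
  | zero => simp
  | succ k ih =>
    have hmono := fun (d : ℕ → (i : Fin n) → Fin (N i)) i =>
      cellCorner_le_succ (t₁ := t₁) (x₀ := x₀) hA hN d k i
    have heq : ∀ j < k, d j = d' j := ih
      (fun i => ⟨(hmono d i).1.trans (hz i).1, (hz i).2.trans_le (hmono d i).2⟩)
      (fun i => ⟨(hmono d' i).1.trans (hz' i).1, (hz' i).2.trans_le (hmono d' i).2⟩)
    intro j hj
    rcases Nat.lt_succ_iff_lt_or_eq.1 hj with hj | rfl
    · exact heq j hj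
    funext i
    have h1 := hz i
    have h2 := hz' i
    simp only [cellCorner, cellCorner_congr heq, Set.mem_Ico] at h1 h2
    set W := weightedSide r (bobLevel a b t₁ (j + 1)) i
    have hW : 0 < W := weightedSide_pos _ _ _
    -- Both cells now sit in the same grid: half-open intervals of width `W` at integer offsets meet
    -- only if the offsets agree.
    have h3 : W * (d j i : ℕ) < W * ((d' j i : ℕ) + 1 : ℕ) := by
      push_cast
      linarith
    have h4 : W * (d' j i : ℕ) < W * ((d j i : ℕ) + 1 : ℕ) := by
      push_cast
      linarith
    have h5 := Nat.cast_lt.1 (lt_of_mul_lt_mul_left h3 hW.le)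
    have h6 := Nat.cast_lt.1 (lt_of_mul_lt_mul_left h4 hW.le)
    exact Fin.ext (by omega)

/-- Every code determines a point lying in all its cells. -/
lemma exists_mem_all_cells (hA : ∀ x t i, x i ≤ A x t i ∧
      A x t i + weightedSide r (t + a) i ≤ x i + weightedSide r t i)
    (hN : ∀ i, N i * weightedSide r b i ≤ 1)
    (d : ℕ → (i : Fin n) → Fin (N i)) :
    ∃ y : Fin n → ℝ, ∀ k i, y i ∈ Set.Icc (cellCorner r A a b t₁ x₀ d k i)
      (cellCorner r A a b t₁ x₀ d k i + weightedSide r (bobLevel a b t₁ k) i) := by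
  refine ⟨fun i => ⨆ k, cellCorner r A a b t₁ x₀ d k i, fun k i => ?_⟩
  have h := Monotone.ciSup_mem_iInter_Icc_of_antitone
    (f := fun k => cellCorner r A a b t₁ x₀ d k i)
    (g := fun k => cellCorner r A a b t₁ x₀ d k i + weightedSide r (bobLevel a b t₁ k) i)
    (monotone_nat_of_le_succ fun k => (cellCorner_le_succ hA hN d k i).1)
    (antitone_nat_of_succ_le fun k => (cellCorner_le_succ hA hN d k i).2)
    (fun k => le_add_of_nonneg_right (weightedSide_pos _ _ _).le)
  exact Set.mem_iInter.1 h k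

end CantorSet

/-! ### Dimension estimate. -/

section Thickness

open MSG MeasureTheory

variable {n : ℕ} {r : Fin n → ℝ} {A : (Fin n → ℝ) → ℝ → Fin n → ℝ} {a b t₁ : ℝ} {x₀ : Fin n → ℝ}
  {N : Fin n → ℕ}

/-- Bounds the loss per round: rounding down the grid costs at most a factor `2` per coordinate, and
Alice's move costs `e^{(n+1)a}`. -/
lemma exp_le_prod_floor_mul (hr : ∀ i, 0 < r i) (hsum : ∑ i, r i = 1) (hb : 0 ≤ b) (a : ℝ) :
    Real.exp ((n + 1) * (a + b)) ≤ ((∏ i, ⌊Real.exp ((1 + r i) * b)⌋₊ : ℕ) : ℝ) *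
      Real.exp (n * Real.log 2 + (n + 1) * a) := by
  have hfloor : ∀ i, Real.exp ((1 + r i) * b) ≤ 2 * (⌊Real.exp ((1 + r i) * b)⌋₊ : ℝ) := fun i => by
    have h1 : (1 : ℝ) ≤ Real.exp ((1 + r i) * b) :=
      Real.one_le_exp (mul_nonneg (by linarith [hr i]) hb)
    have h2 : (1 : ℝ) ≤ ⌊Real.exp ((1 + r i) * b)⌋₊ := by
      exact_mod_cast (Nat.one_le_floor_iff _).2 h1
    linarith [Nat.lt_floor_add_one (Real.exp ((1 + r i) * b))]
  have hprod : Real.exp ((n + 1) * b) ≤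
      2 ^ n * ((∏ i, ⌊Real.exp ((1 + r i) * b)⌋₊ : ℕ) : ℝ) := by
    have h1 : ∏ i, Real.exp ((1 + r i) * b) = Real.exp ((n + 1) * b) := by
      have := prod_exp_weights hsum (-b)
      simpa using this
    have h2 := Finset.prod_le_prod (s := Finset.univ) (fun i _ => (Real.exp_pos _).le)
      (fun i _ => hfloor i)
    rw [h1, Finset.prod_mul_distrib] at h2
    simpa using h2
  have hlog : Real.exp (n * Real.log 2) = 2 ^ n := by
    rw [Real.exp_nat_mul, Real.exp_log two_pos]
  rw [mul_add, Real.exp_add, Real.exp_add, hlog]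
  calc _ ≤ Real.exp ((n + 1) * a) * (2 ^ n * ((∏ i, ⌊Real.exp ((1 + r i) * b)⌋₊ : ℕ) : ℝ)) := by
        gcongr
    _ = _ := by ring

/-- Volume bound for the number of cells of level `k` with a coded point in a ball of radius
`δ ≥ e ^ (- t_k)`. -/
lemma ncard_codes_mul_le (hr : ∀ i, 0 < r i) (hsum : ∑ i, r i = 1)
    (hA : ∀ x t i, x i ≤ A x t i ∧ A x t i + weightedSide r (t + a) i ≤ x i + weightedSide r t i)
    (hN : ∀ i, N i * weightedSide r b i ≤ 1) {π : (ℕ → (i : Fin n) → Fin (N i)) → Fin n → ℝ}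
    (hπ : ∀ ω k i, π ω i ∈ Set.Icc (cellCorner r A a b t₁ x₀ ω k i)
      (cellCorner r A a b t₁ x₀ ω k i + weightedSide r (bobLevel a b t₁ k) i))
    {k : ℕ} (hk : 0 ≤ bobLevel a b t₁ k) {x : Fin n → ℝ} {δ : ℝ}
    (hδ : Real.exp (-bobLevel a b t₁ k) ≤ δ) :
    ({w : Fin k → (i : Fin n) → Fin (N i) | ∃ ω : ℕ → (i : Fin n) → Fin (N i),
      (∀ j : Fin k, ω j = w j) ∧ π ω ∈ Metric.closedBall x δ}.ncard : ℝ) *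
        Real.exp (-((n + 1) * bobLevel a b t₁ k)) ≤ (4 * δ) ^ n := by
  set W := {w : Fin k → (i : Fin n) → Fin (N i) | ∃ ω : ℕ → (i : Fin n) → Fin (N i),
    (∀ j : Fin k, ω j = w j) ∧ π ω ∈ Metric.closedBall x δ} with hW
  have hδ0 : 0 < δ := (Real.exp_pos _).trans_le hδ
  rcases W.eq_empty_or_nonempty with hemp | ⟨_, ω₀, -⟩
  · rw [hemp, Set.ncard_empty, Nat.cast_zero, zero_mul]
    positivity
  have : Nonempty (ℕ → (i : Fin n) → Fin (N i)) := ⟨ω₀⟩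
  choose! ω hω hball using fun (w : Fin k → (i : Fin n) → Fin (N i)) (hw : w ∈ W) => hw
  let X := fun w => cellCorner r A a b t₁ x₀ (ω w) k
  -- Even the longest side of a cell is at most `e^{-t_k} ≤ δ`, so cells with a coded point in the
  -- ball lie in the ball of radius `2 * δ`. Half-open cells make distinct codes disjoint.
  have h := card_mul_le_of_pairwiseDisjoint W.toFinite.toFinset
    (fun w => Set.univ.pi fun i => Set.Ico (X w i) (X w i + weightedSide r (bobLevel a b t₁ k) i))
    (x := x) (R := 2 * δ) (v := Real.exp (-((n + 1) * bobLevel a b t₁ k))) (by positivity)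
    (fun w _ => MeasurableSet.univ_pi fun i => measurableSet_Ico) (fun w _ => ?_) ?_ ?_
  · rwa [← Set.ncard_eq_toFinset_card W, ← mul_assoc, show (2 : ℝ) * 2 = 4 by norm_num] at h
  · rw [Real.volume_pi_Ico, ← prod_exp_weights hsum,
      ENNReal.ofReal_prod_of_nonneg fun i _ => (Real.exp_pos _).le]
    simp [weightedSide]
  · intro w hw w' hw' hne
    rw [Set.Finite.coe_toFinset] at hw hw'
    refine Set.disjoint_left.2 fun z hz hz' => hne ?_
    have hcode := code_eq_of_mem_cells hA hN (fun i => hz i trivial) (fun i => hz' i trivial)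
    funext j
    rw [← hω w hw j, ← hω w' hw' j]
    exact hcode j j.2
  · intro w hw z hz
    have hw : w ∈ W := (Set.Finite.mem_toFinset _).1 hw
    rw [Metric.mem_closedBall, dist_pi_le_iff (by positivity)]
    intro i
    have h1 := hπ (ω w) k i
    have h2 := hz i trivial
    have h3 := (dist_pi_le_iff hδ0.le).1 (Metric.mem_closedBall.1 (hball w hw)) i
    have h4 := (weightedSide_le_exp_neg hr hk i).trans hδ
    simp only [Set.mem_Icc, Set.mem_Ico, X] at h1 h2
    rw [Real.dist_eq, abs_le] at h3 ⊢
    constructor <;> linarith [h1.1, h1.2, h2.1, h2.2, h3.1, h3.2]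

/-- The upper bound on `k` turns the accumulated loss `e^{kL}` into a small power of `δ⁻¹`. -/
lemma exists_first_small_level (hab : 0 < a + b) (ht : 0 ≤ t₁) {δ : ℝ} (hδ0 : 0 < δ)
    (hδ1 : δ ≤ 1) : ∃ k : ℕ, Real.exp (-bobLevel a b t₁ k) ≤ δ ∧
      k * (a + b) ≤ a + b + Real.log δ⁻¹ := by
  have hlog : 0 ≤ Real.log δ⁻¹ := Real.log_nonneg ((one_le_inv₀ hδ0).2 hδ1)
  refine ⟨⌈Real.log δ⁻¹ / (a + b)⌉₊, ?_, ?_⟩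
  · rw [← Real.le_log_iff_exp_le hδ0, neg_le, ← Real.log_inv]
    have := (div_le_iff₀ hab).1 (Nat.le_ceil (Real.log δ⁻¹ / (a + b)))
    rw [bobLevel]
    linarith
  · have := (Nat.ceil_lt_add_one (div_nonneg hlog hab.le)).le
    calc _ ≤ (Real.log δ⁻¹ / (a + b) + 1) * (a + b) := by gcongr
      _ = _ := by
        field_simp
        ring

lemma le_dimH_bad_inter (hr : ∀ i, 0 < r i) (hsum : ∑ i, r i = 1) {U : Set (Fin n → ℝ)}
    (hU : IsOpen U) (hne : U.Nonempty) (s : NNReal) (hs : (s : ℝ) < n) :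
    (s : ENNReal) ≤ dimH (Bad r ∩ U) := by
  obtain ⟨x₀, hx₀⟩ := hne
  obtain ⟨a₀, hstrat⟩ := exists_positional_strategy hr hsum (isAdmissible_Icc_zero_one (n := n))
  set a := max a₀ 0 with ha
  have ha0 : 0 ≤ a := le_max_right _ _
  obtain ⟨A, hle, hwin⟩ := hstrat a (le_max_left _ _)
  have hA : ∀ x t i, x i ≤ A x t i ∧
      A x t i + weightedSide r (t + a) i ≤ x i + weightedSide r t i :=
    fun x t => inducedLe_Icc_iff.1 (hle x t)
  set L : ℝ := n * Real.log 2 + (n + 1) * a with hL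
  have hL0 : 0 ≤ L := by
    have := Real.log_nonneg one_le_two
    positivity
  have hns : 0 < (n : ℝ) - s := sub_pos.2 hs
  -- Large enough that the loss of dimension `L / (a + b)` is strictly less than `n - s`.
  set b : ℝ := L / (n - s) + 1 with hb
  have hb0 : 0 < b := by positivity
  have hab : 0 < a + b := by positivity
  have hη : L / (a + b) < n - s := by
    rw [div_lt_comm₀ hab hns]
    linarith
  set N : Fin n → ℕ := fun i => ⌊Real.exp ((1 + r i) * b)⌋₊ with hNdef
  have hN1 : ∀ i, 0 < N i := fun i => Nat.floor_pos.2
    (Real.one_le_exp (mul_nonneg (by linarith [hr i]) hb0.le))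
  have hN : ∀ i, N i * weightedSide r b i ≤ 1 := fun i => by
    calc N i * weightedSide r b i ≤ Real.exp ((1 + r i) * b) * weightedSide r b i := by
          gcongr
          · exact (weightedSide_pos _ _ _).le
          · exact Nat.floor_le (Real.exp_nonneg _)
      _ = 1 := by rw [weightedSide, ← Real.exp_add, add_neg_cancel, Real.exp_zero]
  have : ∀ i, Nonempty (Fin (N i)) := fun i => ⟨⟨0, hN1 i⟩⟩
  obtain ⟨ρ, hρ, hballU⟩ := Metric.nhds_basis_closedBall.mem_iff.1 (hU.mem_nhds hx₀)
  -- Bob starts at a level so deep that his first box lies in `U`.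
  obtain ⟨t₁, ht₁, hexp⟩ := exists_forall_mul_exp_neg_le 1 hρ
  have hlevel : ∀ k, 0 ≤ bobLevel a b t₁ k := fun k => by
    rw [bobLevel]
    positivity
  choose π hπ using fun ω => exists_mem_all_cells (t₁ := t₁) (x₀ := x₀) (N := N) hA hN ω
  have hdist : ∀ ω k y, (∀ i, y i ∈ Set.Icc (cellCorner r A a b t₁ x₀ ω k i)
      (cellCorner r A a b t₁ x₀ ω k i + weightedSide r (bobLevel a b t₁ k) i)) →
      dist (π ω) y ≤ Real.exp (-bobLevel a b t₁ k) := fun ω k y hy => by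
    refine (dist_pi_le_iff (Real.exp_nonneg _)).2 fun i => ?_
    have h1 := hπ ω k i
    have h2 := hy i
    have h3 := weightedSide_le_exp_neg hr (hlevel k) i
    simp only [Set.mem_Icc] at h1 h2
    rw [Real.dist_eq, abs_le]
    constructor <;> linarith [h1.1, h1.2, h2.1, h2.2]
  have hcont : Continuous π := by
    rw [continuous_iff_continuousAt]
    intro ω
    rw [Metric.continuousAt_iff']
    intro ε hε
    obtain ⟨k, hk, -⟩ := exists_first_small_level (a := a) (b := b) (t₁ := t₁) hab ht₁
      (lt_min (half_pos hε) one_pos) (min_le_right _ _)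
    have hopen : {ω' : ℕ → (i : Fin n) → Fin (N i) | ∀ j ∈ Set.Iio k, ω' j ∈ ({ω j} : Set _)} ∈
        nhds ω :=
      set_pi_mem_nhds (Set.finite_Iio k) fun j _ => (isOpen_discrete _).mem_nhds rfl
    filter_upwards [hopen] with ω' hω'
    refine (hdist ω' k (π ω) fun i => ?_).trans_lt ?_
    · rw [cellCorner_congr (d' := ω) fun j hj => hω' j hj]
      exact hπ ω k i
    · exact (hk.trans (min_le_left _ _)).trans_lt (half_lt_self hε)
  have hrange : Set.range π ⊆ Bad r ∩ U := by
    rintro _ ⟨ω, rfl⟩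
    constructor
    -- Each code is a legal play for Bob against Alice's strategy, and its point lies in all his
    -- boxes.
    · refine hwin b t₁ (cellCorner r A a b t₁ x₀ ω) hab
        (fun k => inducedLe_Icc_iff.2 fun i => cellCorner_succ_mem hN ω k i) ?_
      refine Set.mem_iInter.2 fun k => ?_
      rw [bobPos, inducedPsi_Icc_zero_one]
      exact ⟨fun i => (hπ ω k i).1, fun i => (hπ ω k i).2⟩
    · refine hballU (Metric.mem_closedBall.2 ((hdist ω 0 x₀ fun i => ?_).trans ?_))
      · exact ⟨le_rfl, le_add_of_nonneg_right (weightedSide_pos _ _ _).le⟩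
      · have := hexp t₁ le_rfl
        simpa [bobLevel] using this
  refine le_trans ?_ (dimH_mono hrange)
  have hNcard : Real.exp ((n + 1) * (a + b)) ≤
      (Fintype.card ((i : Fin n) → Fin (N i)) : ℝ) * Real.exp L := by
    rw [Fintype.card_pi]
    simp only [Fintype.card_fin]
    exact exp_le_prod_floor_mul hr hsum hb0.le a
  refine le_dimH_range_of_coding π hcont
    (C := 4 ^ n * Real.exp ((n + 1) * t₁) * Real.exp L) (s := n - L / (a + b))
    (fun x δ hδ0 hδ1 => ?_) s (by linarith)
  obtain ⟨k, hk, hkδ⟩ := exists_first_small_level (t₁ := t₁) hab ht₁ hδ0 hδ1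
  refine ⟨k, ?_⟩
  have hcount := ncard_codes_mul_le hr hsum hA hN hπ (hlevel k) (x := x) hk
  rw [Real.exp_neg, ← div_eq_mul_inv, div_le_iff₀ (Real.exp_pos _)] at hcount
  refine hcount.trans ?_
  have h1 : Real.exp ((n + 1) * bobLevel a b t₁ k) ≤ Real.exp ((n + 1) * t₁) *
      ((Fintype.card ((i : Fin n) → Fin (N i)) : ℝ) ^ k * Real.exp (k * L)) := by
    have : ((n : ℝ) + 1) * bobLevel a b t₁ k = (n + 1) * t₁ + k * ((n + 1) * (a + b)) := by
      rw [bobLevel]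
      ring
    rw [this, Real.exp_add, Real.exp_nat_mul, Real.exp_nat_mul, ← mul_pow]
    gcongr
  have h2 : Real.exp (k * L) ≤ Real.exp L * δ ^ (-(L / (a + b))) := by
    rw [Real.rpow_def_of_pos hδ0, ← Real.exp_add]
    refine Real.exp_le_exp.2 ?_
    calc k * L = k * (a + b) * (L / (a + b)) := by field_simp
      _ ≤ (a + b + Real.log δ⁻¹) * (L / (a + b)) := by gcongr
      _ = L + Real.log δ * -(L / (a + b)) := by
        rw [Real.log_inv]
        field_simp
  calc (4 * δ) ^ n * Real.exp ((n + 1) * bobLevel a b t₁ k)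
      ≤ (4 * δ) ^ n * (Real.exp ((n + 1) * t₁) *
        ((Fintype.card ((i : Fin n) → Fin (N i)) : ℝ) ^ k *
          (Real.exp L * δ ^ (-(L / (a + b)))))) := by
        refine mul_le_mul_of_nonneg_left (h1.trans ?_) (by positivity)
        gcongr
    _ = _ := by
        rw [sub_eq_add_neg, Real.rpow_add hδ0, Real.rpow_natCast, mul_pow]
        ring

theorem bad_isThick (hr : ∀ i, 0 < r i) (hsum : ∑ i, r i = 1) : IsThick (Bad r) := by
  intro U hU hne
  refine le_antisymm ((dimH_mono (Set.subset_univ _)).trans (Real.dimH_univ_pi_fin n).le) ?_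
  refine ENNReal.le_of_forall_nnreal_lt fun s hs => le_dimH_bad_inter hr hsum hU hne s ?_
  have : s < (n : NNReal) := by exact_mod_cast hs
  exact_mod_cast this

end Thickness

theorem theorem1p1 (n : ℕ) (r : Fin n → ℝ) (hr : ∀ i, 0 < r i) (hsum : ∑ i, r i = 1) :
    (∀ D₀ : Set (Fin n → ℝ), MSG.IsAdmissible D₀ →
      (∃ aStar : ℝ, 0 ≤ aStar ∧ MSG.MSG0 (MSG.inducedLe (weightedContraction r) D₀) aStar) ∧
      ∀ aStar : ℝ, 0 ≤ aStar → MSG.MSG0 (MSG.inducedLe (weightedContraction r) D₀) aStar →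
        MSG.IsWinning (MSG.inducedLe (weightedContraction r) D₀)
          (MSG.inducedPsi (weightedContraction r) D₀) aStar (Bad r)) ∧
    IsThick (Bad r) :=
  ⟨fun _ hD => ⟨exists_msg0 hr hD, fun _ ha _ => bad_isWinning hr hsum hD ha⟩,
    bad_isThick hr hsum⟩
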